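/- Notation. For integers $c,N\ge 0$, the positive Grassmannian $\mathrm{Gr}_+(c,N)$ is the set of $c$-dimensional linear subspaces of $\mathbb{R}^N$ that are the row space of a real $c\times N$ matrix all of whose maximal minors are positive. A subset $X\subseteq\mathbb{C}^N$ of codimension $c$ is called positively hyperbolic if for every $L\in\mathrm{Gr}_+(c,N)$ and every $x\in X$ the coordinatewise imaginary part $\mathrm{Im}(x)\in\mathbb{R}^N$ does not lie in $L\setminus\{0\}$; a projective variety of codimension $c$ in $\mathbb{P}^{N-1}(\mathbb{C})$ is called positively hyperbolic if its affine cone in $\mathbb{C}^N$, which again has codimension $c$, is. For a $c$-dimensional linear subspace $L\subseteq\mathbb{R}^N$, a subset $Z\subseteq\mathbb{P}^{N-1}(\mathbb{C})$ of codimension $c$ is called hyperbolic with respect to $L$ if $Z\cap\mathbb{P}(L_{\mathbb{C}})=\emptyset$ and, for every linear subspace $L'\subseteq\mathbb{R}^N$ of dimension $c+1$ with $L\subseteq L'$, the intersection $Z\cap\mathbb{P}(L'_{\mathbb{C}})$ consists only of real points, i.e. of points that have real homogeneous coordinates. Here $L_{\mathbb{C}}\subseteq\mathbb{C}^N$ denotes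 the complex span of $L$. Proposition. Let $X\subseteq\mathbb{C}^n$ be a real variety, i.e. the common zero set in $\mathbb{C}^n$ of a set of polynomials in $\mathbb{R}[x_1,\dots,x_n]$, of codimension $c$ (that is, $X$ is non-empty and $\dim X=n-c$). Let $\overline{X}\subseteq\mathbb{P}^n(\mathbb{C})$ be its projective closure, that is, the Zariski closure of the image of $X$ under $x\mapsto[1:x]$. Then: (a) $\overline{X}$ is positively hyperbolic if and only if $\overline{X}$ is hyperbolic with respect to every $L\in\mathrm{Gr}_+(c,n+1)$. (b) $X$ is positively hyperbolic if and only if $\overline{X}$ is hyperbolic with respect to $\{0\}\times L\subseteq\mathbb{R}^{n+1}$ for every $L\in\mathrm{Gr}_+(c,n)$. -/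

import Mathlib

noncomputable section

open MvPolynomial

namespace PosHyp

/-- The imaginary part of a vector of complex numbers, taken coordinatewise. -/
def imVec {N : ℕ} (z : Fin N → ℂ) : Fin N → ℝ := fun i => (z i).im

/-! ### Affine varieties -/

/-- `X ⊆ ℂⁿ` is a real (affine) variety: the common zero set in `ℂⁿ` of a set of polynomials
with real coefficients (equivalently, of the ideal they generate). -/
def IsRealVariety {n : ℕ} (X : Set (Fin n → ℂ)) : Prop :=
  ∃ I : Ideal (MvPolynomial (Fin n) ℝ), X = zeroLocus ℂ I

/-- `X ⊆ ℂⁿ` has codimension `c`: its coordinate ring `ℂ[x₁, …, xₙ] / I(X)` has Krull dimension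
`d` with `d + c = n`.  (For empty `X` the dimension is `⊥`, so no `c` qualifies.) -/
def HasCodim {n : ℕ} (X : Set (Fin n → ℂ)) (c : ℕ) : Prop :=
  ringKrullDim (MvPolynomial (Fin n) ℂ ⧸ vanishingIdeal ℂ X) + (c : WithBot ℕ∞) =
    (n : WithBot ℕ∞)

/-! ### The positive Grassmannian and positive hyperbolicity -/

/-- The positive Grassmannian `Gr₊(c, N)`: the `c`-dimensional linear subspaces of `ℝᴺ` that are
the row space of a real `c × N` matrix all of whose maximal minors are positive.  A choice of `c`
columns, kept in their order, is an order embedding `Fin c ↪o Fin N`. -/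
def positiveGrassmannian (c N : ℕ) : Set (Submodule ℝ (Fin N → ℝ)) :=
  {L | Module.finrank ℝ L = c ∧
    ∃ A : Matrix (Fin c) (Fin N) ℝ,
      L = Submodule.span ℝ (Set.range A.row) ∧
      ∀ s : Fin c ↪o Fin N, 0 < (A.submatrix id s).det}

/-- Positive hyperbolicity of a subset of `ℂᴺ` of codimension `c`: for no point `x` of it and no
`L ∈ Gr₊(c, N)` does `Im x` lie in `L \ {0}`. -/
def PositivelyHyperbolic {N : ℕ} (c : ℕ) (X : Set (Fin N → ℂ)) : Prop :=
  ∀ L ∈ positiveGrassmannian c N, ∀ x ∈ X, imVec x ∉ (L : Set (Fin N → ℝ)) \ {0}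

/-! ### Projective space -/

/-- Complex projective space with `N` homogeneous coordinates, i.e. `ℙ^{N-1}(ℂ)`. -/
abbrev CProj (N : ℕ) : Type := Projectivization ℂ (Fin N → ℂ)

/-- The affine cone in `ℂᴺ` over a subset of `ℙ^{N-1}(ℂ)`. -/
def affineCone {N : ℕ} (Z : Set (CProj N)) : Set (Fin N → ℂ) :=
  {v | v = 0 ∨ ∃ hv : v ≠ 0, Projectivization.mk ℂ v hv ∈ Z}

/-- Positive hyperbolicity of a subset of projective space of codimension `c`: that of its affine
cone (which has the same codimension). -/
def ProjPositivelyHyperbolic {N : ℕ} (c : ℕ) (Z : Set (CProj N)) : Prop :=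
  PositivelyHyperbolic c (affineCone Z)

/-- Zariski closed subsets of projective space: the common zero sets of sets of homogeneous
polynomials. (The vanishing of a homogeneous polynomial does not depend on the representative.) -/
def IsProjVariety {N : ℕ} (Z : Set (CProj N)) : Prop :=
  ∃ S : Set (MvPolynomial (Fin N) ℂ),
    (∀ F ∈ S, ∃ d : ℕ, F.IsHomogeneous d) ∧
    Z = {p : CProj N | ∀ F ∈ S, eval p.rep F = 0}

/-- The standard embedding `ℂⁿ → ℙⁿ(ℂ)`, `x ↦ [1 : x]`. -/
def toProj {n : ℕ} (x : Fin n → ℂ) : CProj (n + 1) :=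
  Projectivization.mk ℂ (Fin.cons 1 x : Fin (n + 1) → ℂ) (fun h => one_ne_zero (congrFun h 0))

/-- The projective closure of `X ⊆ ℂⁿ`: the smallest Zariski closed subset of `ℙⁿ(ℂ)` that
contains the image of `X`. -/
def projClosure {n : ℕ} (X : Set (Fin n → ℂ)) : Set (CProj (n + 1)) :=
  ⋂₀ {Z | IsProjVariety Z ∧ toProj '' X ⊆ Z}

/-! ### Hyperbolicity with respect to a real linear subspace -/

/-- The complexification `L_ℂ ⊆ ℂᴺ` of a linear subspace `L ⊆ ℝᴺ`. -/
def complexify {N : ℕ} (L : Submodule ℝ (Fin N → ℝ)) : Submodule ℂ (Fin N → ℂ) :=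
  Submodule.span ℂ ((fun (v : Fin N → ℝ) (i : Fin N) => (v i : ℂ)) '' (L : Set (Fin N → ℝ)))

/-- The linear subspace of `ℙ^{N-1}(ℂ)` defined over `ℝ` that is given by `L ⊆ ℝᴺ`.  Its
projective dimension is `dim L - 1`. -/
def projSubspace {N : ℕ} (L : Submodule ℝ (Fin N → ℝ)) : Set (CProj N) :=
  {p | p.rep ∈ complexify L}

/-- A point of complex projective space is real if it has real homogeneous coordinates. -/
def IsRealPoint {N : ℕ} (p : CProj N) : Prop :=
  ∃ (v : Fin N → ℝ) (hv : (fun i => (v i : ℂ)) ≠ (0 : Fin N → ℂ)),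
    p = Projectivization.mk ℂ (fun i => (v i : ℂ)) hv

/-- Hyperbolicity of `Z ⊆ ℙ^{N-1}(ℂ)` with respect to (the projective subspace given by) `L`, in the
sense of Shamovich and Vinnikov: `Z` does not meet `L`, and it meets every real linear subspace
`L'` containing `L` of dimension one more only in real points. -/
def HyperbolicWRT {N : ℕ} (Z : Set (CProj N)) (L : Submodule ℝ (Fin N → ℝ)) : Prop :=
  Z ∩ projSubspace L = ∅ ∧
    ∀ L' : Submodule ℝ (Fin N → ℝ), L ≤ L' →
      Module.finrank ℝ L' = Module.finrank ℝ L + 1 →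
      ∀ p ∈ Z ∩ projSubspace L', IsRealPoint p

/-- The subspace `{0} × L ⊆ ℝ^{n+1}` for `L ⊆ ℝⁿ`; the `0` is the coordinate that `toProj` sets to
`1`. -/
def zeroProd {n : ℕ} (L : Submodule ℝ (Fin n → ℝ)) : Submodule ℝ (Fin (n + 1) → ℝ) :=
  LinearMap.ker (LinearMap.proj (R := ℝ) (φ := fun _ : Fin (n + 1) => ℝ) 0) ⊓
    L.comap (LinearMap.funLeft ℝ ℝ Fin.succ)

end PosHyp

end

noncomputable section

open MvPolynomial

namespace PosHyp

/-! Hyperbolicity of `Z` with respect to `L` means that no homogeneous coordinate vector `v` of a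
point of `Z` has `Im v` in `L \ {0}` (`hyperbolicWRT_iff`). With this, (a) is the definition of the
affine cone.

In (b), `x ↦ (1, x)` gives one direction. For the other, let `v` represent a point of the closure,
with `v 0` real and the imaginary part of its tail in `L \ {0}`. If `v 0 ≠ 0`, dividing by the real
number `v 0` gives a forbidden point of `X`. If `v 0 = 0`, the tail is a limit of vectors `t • x`
with `t > 0` and `x ∈ X` (`exists_pos_smul_mem_of_mem_projClosure`). The nonzero vectors in members
of the positive Grassmannian form an open set (`eventually_mem_positiveGrassmannian`), so some such
`x` is already forbidden.

The approximation must use positive real `t`, since a complex factor would mix real and imaginary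
parts. To get it, take the cone over the closure of an irreducible component and project it linearly
and finitely onto an affine space having `x₀` as a coordinate
(`exists_linear_noether_normalization`). Such a map is open in the Euclidean topology
(`eventually_exists_preimage_mem`), so moving `x₀` from `0` to a small `t > 0` lifts to a small move
on the cone. -/

/-! ### Hyperbolicity via imaginary parts; openness of the positive Grassmannian condition -/

theorem mem_complexify_iff {N : ℕ} (L : Submodule ℝ (Fin N → ℝ)) (z : Fin N → ℂ) :
    z ∈ complexify L ↔ (fun i => (z i).re) ∈ L ∧ imVec z ∈ L := by
  constructor
  · intro hz
    induction hz using Submodule.span_induction with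
    | mem x hx =>
      obtain ⟨v, hv, rfl⟩ := hx
      refine ⟨by simpa using hv, ?_⟩
      have : imVec (fun i => (v i : ℂ)) = 0 := by ext i; simp [imVec]
      rw [this]; exact L.zero_mem
    | zero => exact ⟨L.zero_mem, L.zero_mem⟩
    | add x y _ _ hx hy => exact ⟨L.add_mem hx.1 hy.1, L.add_mem hx.2 hy.2⟩
    | smul a x _ hx =>
      constructor
      · convert L.sub_mem (L.smul_mem a.re hx.1) (L.smul_mem a.im hx.2) using 1
        ext i; simp [imVec]
      · convert L.add_mem (L.smul_mem a.re hx.2) (L.smul_mem a.im hx.1) using 1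
        ext i; simp [imVec]
  · rintro ⟨h1, h2⟩
    have e : z = (fun i => ((z i).re : ℂ)) + Complex.I • (fun i => (imVec z i : ℂ)) := by
      ext i; simp [imVec, mul_comm Complex.I, Complex.re_add_im]
    rw [e]
    exact Submodule.add_mem _ (Submodule.subset_span ⟨_, h1, rfl⟩)
      (Submodule.smul_mem _ _ (Submodule.subset_span ⟨_, h2, rfl⟩))

theorem mk_eq_of_smul {N : ℕ} {v w : Fin N → ℂ} (hv : v ≠ 0) (hw : w ≠ 0) (a : ℂ)
    (h : w = a • v) : Projectivization.mk ℂ w hw = Projectivization.mk ℂ v hv :=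
  (Projectivization.mk_eq_mk_iff' ℂ w v hw hv).2 ⟨a, h.symm⟩

theorem exists_rep_mk {N : ℕ} {v : Fin N → ℂ} (hv : v ≠ 0) :
    ∃ a : ℂ, a ≠ 0 ∧ (Projectivization.mk ℂ v hv).rep = a • v := by
  obtain ⟨a, ha⟩ := Projectivization.exists_smul_eq_mk_rep ℂ v hv
  exact ⟨a, a.ne_zero, ha.symm⟩

theorem eq_ofReal_re_of_imVec_eq_zero {N : ℕ} {v : Fin N → ℂ} (h : imVec v = 0) :
    v = fun i => (((v i).re : ℝ) : ℂ) := by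
  ext i
  exact Complex.ext rfl (by simpa [imVec] using congrFun h i)

/-- Hyperbolicity in terms of imaginary parts of homogeneous coordinates. -/
theorem hyperbolicWRT_iff {N : ℕ} (Z : Set (CProj N)) (L : Submodule ℝ (Fin N → ℝ)) :
    HyperbolicWRT Z L ↔
      ∀ v (hv : v ≠ 0), Projectivization.mk ℂ v hv ∈ Z → imVec v ∈ L → imVec v = 0 := by
  constructor
  · rintro ⟨h1, h2⟩ v hv hZ hL
    obtain ⟨a, ha, hrep⟩ := exists_rep_mk hv
    have hmem : ∀ L' : Submodule ℝ (Fin N → ℝ), (fun i => (v i).re) ∈ L' → imVec v ∈ L' →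
        Projectivization.mk ℂ v hv ∈ Z ∩ projSubspace L' := by
      intro L' hre him
      refine ⟨hZ, ?_⟩
      change _ ∈ complexify L'
      rw [hrep]
      exact Submodule.smul_mem _ _ ((mem_complexify_iff _ _).2 ⟨hre, him⟩)
    -- If `Re v` is also in `L`, the point lies in the subspace of `L`, which is excluded. Otherwise
    -- it lies in that of `L + ℝ Re v`, so `v` is a complex multiple of a real `w`; a nonzero `Im v
    -- ∈ L` would then put `w`, hence `Re v`, in `L`.
    by_cases hre : (fun i => (v i).re) ∈ L
    · have := hmem L hre hL
      rw [h1] at this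
      exact this.elim
    obtain ⟨w, hw, hp⟩ := h2 (L ⊔ Submodule.span ℝ {fun i => (v i).re}) le_sup_left
      (Submodule.finrank_sup_span_singleton hre) _
      (hmem _ (Submodule.mem_sup_right (Submodule.mem_span_singleton_self _))
        (Submodule.mem_sup_left hL))
    obtain ⟨b, hb⟩ := (Projectivization.mk_eq_mk_iff' ℂ _ _ _ _).1 hp
    by_contra him
    apply hre
    have e1 : (fun i => (v i).re) = b.re • w := by ext i; simp [← hb]
    have e2 : imVec v = b.im • w := by ext i; simp [← hb, imVec]
    have hb0 : b.im ≠ 0 := by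
      rintro h0
      exact him (by rw [e2, h0, zero_smul])
    rw [e2, L.smul_mem_iff hb0] at hL
    rw [e1]
    exact L.smul_mem _ hL
  · intro h
    have key : ∀ p ∈ Z, ∀ a : ℂ, a ≠ 0 → imVec (a • p.rep) ∈ L → imVec (a • p.rep) = 0 := by
      intro p hp a ha hL
      refine h _ (smul_ne_zero ha p.rep_nonzero) ?_ hL
      rwa [mk_eq_of_smul p.rep_nonzero _ a rfl, p.mk_rep]
    have him : ∀ (a : ℂ) (v : Fin N → ℂ), imVec (a • v) = a.re • imVec v +
        a.im • (fun i => (v i).re) := by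
      intro a v; ext i; simp [imVec]
    refine ⟨?_, ?_⟩
    · rw [Set.eq_empty_iff_forall_notMem]
      rintro p ⟨hpZ, hpL⟩
      obtain ⟨hre, hi⟩ := (mem_complexify_iff _ _).1 hpL
      have k1 := key p hpZ 1 one_ne_zero (by simpa using hi)
      have k2 := key p hpZ Complex.I Complex.I_ne_zero (by simpa [him] using hre)
      simp [him] at k1 k2
      apply p.rep_nonzero
      ext i
      exact Complex.ext (congrFun k2 i) (congrFun k1 i)
    · rintro L' hLL' hfin p ⟨hpZ, hpL'⟩
      obtain ⟨hre, hi⟩ := (mem_complexify_iff _ _).1 hpL'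
      -- When `Im p ∉ L`, it spans `L'` modulo `L`, so `Re p = l + μ Im p` with `l ∈ L`; multiplying
      -- by `-μ + i` makes the imaginary part equal to `l`.
      obtain ⟨a, ha, haL⟩ : ∃ a : ℂ, a ≠ 0 ∧ imVec (a • p.rep) ∈ L := by
        by_cases hi' : imVec p.rep ∈ L
        · exact ⟨1, one_ne_zero, by simpa using hi'⟩
        have e : L ⊔ Submodule.span ℝ {imVec p.rep} = L' := by
          apply Submodule.eq_of_le_of_finrank_eq
          · exact sup_le hLL' ((Submodule.span_singleton_le_iff_mem _ _).2 hi)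
          · rw [Submodule.finrank_sup_span_singleton hi', hfin]
        rw [← e] at hre
        obtain ⟨l, hl, m, hm, hlm⟩ := Submodule.mem_sup.1 hre
        obtain ⟨μ, rfl⟩ := Submodule.mem_span_singleton.1 hm
        refine ⟨⟨-μ, 1⟩, fun h => one_ne_zero (congrArg Complex.im h), ?_⟩
        rw [him, ← hlm]
        simpa using hl
      have h0 := eq_ofReal_re_of_imVec_eq_zero (key p hpZ a ha haL)
      have hne := smul_ne_zero ha p.rep_nonzero
      refine ⟨fun i => ((a • p.rep) i).re, by rwa [← h0], ?_⟩
      conv_lhs => rw [← p.mk_rep]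
      exact (mk_eq_of_smul p.rep_nonzero _ a h0.symm).symm

/-- The nonzero vectors that lie in some member of the positive Grassmannian form an open set. -/
theorem eventually_mem_positiveGrassmannian {c N : ℕ} {L : Submodule ℝ (Fin N → ℝ)}
    (hL : L ∈ positiveGrassmannian c N) {b : Fin N → ℝ} (hb : b ∈ L) (hb0 : b ≠ 0) :
    ∀ᶠ b' in nhds b, b' ≠ 0 ∧ ∃ L' ∈ positiveGrassmannian c N, b' ∈ L' := by
  obtain ⟨hfin, A, rfl, hA⟩ := hL
  obtain ⟨l, rfl⟩ := (Submodule.mem_span_range_iff_exists_fun ℝ).1 hb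
  obtain ⟨i₀, hi₀⟩ : ∃ i, l i ≠ 0 := by
    by_contra! h
    exact hb0 (by simp [h])
  set b := ∑ i, l i • A.row i with hbdef
  -- Only a row with nonzero coefficient is changed, by exactly what makes the same coefficients `l`
  -- combine the rows to `b'`. The finitely many minors stay positive near `b`.
  let B : (Fin N → ℝ) → Matrix (Fin c) (Fin N) ℝ :=
    fun b' => A.updateRow i₀ (A i₀ + (l i₀)⁻¹ • (b' - b))
  have hBb : B b = A := by simp [B]
  have hB : Continuous B := by
    apply Continuous.matrix_updateRow <;> fun_prop
  have hpos : ∀ᶠ b' in nhds b, ∀ s : Fin c ↪o Fin N, 0 < ((B b').submatrix id s).det := by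
    rw [Filter.eventually_all]
    intro s
    have hc : Continuous fun b' => ((B b').submatrix id s).det :=
      (hB.matrix_submatrix id s).matrix_det
    refine hc.continuousAt.eventually (lt_mem_nhds ?_)
    simpa [hBb] using hA s
  have hcN : c ≤ N := by
    have := Submodule.finrank_le (Submodule.span ℝ (Set.range A.row))
    simpa [hfin] using this
  filter_upwards [hpos, isOpen_ne.mem_nhds hb0] with b' hb' hne
  refine ⟨hne, Submodule.span ℝ (Set.range (B b').row), ⟨?_, B b', rfl, hb'⟩, ?_⟩
  · have hs := hb' (Fin.castLEOrderEmb hcN)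
    have hli : LinearIndependent ℝ ((B b').submatrix id (Fin.castLEOrderEmb hcN)).row :=
      Matrix.linearIndependent_rows_of_det_ne_zero hs.ne'
    have hli' : LinearIndependent ℝ (B b').row :=
      LinearIndependent.of_comp (LinearMap.funLeft ℝ ℝ (Fin.castLEOrderEmb hcN)) hli
    simpa using finrank_span_eq_card hli'
  · have : b' = ∑ i, l i • (B b').row i := by
      have e : ∀ i, l i • (B b').row i = l i • A.row i + if i = i₀ then b' - b else 0 := by
        intro i
        by_cases hi : i = i₀
        · subst hi
          simp [B, Matrix.row, smul_smul, hi₀, smul_add]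
        · simp [B, Matrix.row, hi]
      simp [e, Finset.sum_add_distrib, ← hbdef]
    have hm : ∑ i, l i • (B b').row i ∈ Submodule.span ℝ (Set.range (B b').row) :=
      Submodule.sum_mem _ fun i _ => Submodule.smul_mem _ _ (Submodule.subset_span ⟨i, rfl⟩)
    rwa [← this] at hm

/-! ### Homogeneous polynomials -/

theorem aeval_mul_of_isHomogeneous {σ k Q : Type*} [CommRing k] [CommRing Q] [Algebra k Q]
    {F : MvPolynomial σ k} {d : ℕ} (hF : F.IsHomogeneous d) (v : σ → Q) (u : Q) :
    aeval (fun i => v i * u) F = aeval v F * u ^ d := by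
  simp only [aeval_def, eval₂_eq, Finset.sum_mul]
  refine Finset.sum_congr rfl fun m hm => ?_
  have hd : m.degree = d := by
    by_contra h
    exact (mem_support_iff.1 hm) (hF.coeff_eq_zero h)
  rw [← hd, Finsupp.degree_apply, mul_assoc]
  simp only [mul_pow, Finset.prod_mul_distrib, Finset.prod_pow_eq_pow_sum]

theorem coeff_aeval_C_mul_X {σ k B : Type*} [CommRing k] [CommRing B] [Algebra k B]
    (b : σ → B) (F : MvPolynomial σ k) (d : ℕ) :
    (aeval (fun i => Polynomial.C (b i) * Polynomial.X) F).coeff d =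
      aeval b (homogeneousComponent d F) := by
  conv_lhs => rw [← sum_homogeneousComponent F]
  have h : ∀ i, (aeval (fun i => Polynomial.C (b i) * Polynomial.X) (homogeneousComponent i F)) =
      Polynomial.C (aeval b (homogeneousComponent i F)) * Polynomial.X ^ i := by
    intro i
    rw [aeval_mul_of_isHomogeneous (homogeneousComponent_isHomogeneous i F)]
    congr 1
    exact aeval_algebraMap_apply (Polynomial B) b _
  rw [map_sum, Polynomial.finsetSum_coeff]
  simp only [h, Polynomial.coeff_C_mul_X_pow]
  rw [Finset.sum_ite_eq]
  split_ifs with hd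
  · rfl
  · rw [homogeneousComponent_eq_zero, map_zero]
    simpa using hd

/-- `Q` is arbitrary so that one `F` can be evaluated both at points and in a coordinate ring. -/
theorem exists_homogenization {n : ℕ} {k : Type*} [CommRing k] (G : MvPolynomial (Fin n) k) :
    ∃ F : MvPolynomial (Fin (n + 1)) k, F.IsHomogeneous G.totalDegree ∧
      ∀ (Q : Type) [CommRing Q] [Algebra k Q] (v : Fin n → Q) (u : Q),
        aeval (Fin.cons u (fun i => v i * u) : Fin (n + 1) → Q) F =
          aeval v G * u ^ G.totalDegree := by
  refine ⟨∑ d ∈ Finset.range (G.totalDegree + 1),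
    X 0 ^ (G.totalDegree - d) * rename Fin.succ (homogeneousComponent d G), ?_, ?_⟩
  · refine IsHomogeneous.sum _ _ _ fun d hd => ?_
    have hd' : d ≤ G.totalDegree := by simpa [Nat.lt_succ_iff] using hd
    have := (isHomogeneous_X_pow (R := k) (0 : Fin (n + 1)) (G.totalDegree - d)).mul
      ((homogeneousComponent_isHomogeneous d G).rename_isHomogeneous (f := Fin.succ))
    rwa [Nat.sub_add_cancel hd'] at this
  · intro Q _ _ v u
    have e : aeval v G = ∑ d ∈ Finset.range (G.totalDegree + 1),
        aeval v (homogeneousComponent d G) := by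
      rw [← map_sum, sum_homogeneousComponent]
    rw [map_sum, e, Finset.sum_mul]
    refine Finset.sum_congr rfl fun d hd => ?_
    have hd' : d ≤ G.totalDegree := by simpa [Nat.lt_succ_iff] using hd
    rw [map_mul, map_pow, aeval_X, aeval_rename, Fin.cons_zero]
    have : (Fin.cons u (fun i => v i * u) : Fin (n + 1) → Q) ∘ Fin.succ = fun i => v i * u := by
      ext i; simp
    rw [this, aeval_mul_of_isHomogeneous (homogeneousComponent_isHomogeneous d G),
      mul_left_comm, ← pow_add, Nat.sub_add_cancel hd']

/-! ### Zariski closure in projective space -/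

theorem eval_smul_of_isHomogeneous {N : ℕ} {F : MvPolynomial (Fin N) ℂ} {d : ℕ}
    (hF : F.IsHomogeneous d) (v : Fin N → ℂ) (a : ℂ) :
    eval (a • v) F = a ^ d * eval v F := by
  have := aeval_mul_of_isHomogeneous hF v a
  simp only [aeval_def, Algebra.algebraMap_self, eval₂_id] at this
  rw [mul_comm, ← this]
  congr 2
  ext i
  simp [mul_comm]

theorem eval_rep_mk_eq_zero_iff {N : ℕ} {F : MvPolynomial (Fin N) ℂ} {d : ℕ}
    (hF : F.IsHomogeneous d) {v : Fin N → ℂ} (hv : v ≠ 0) :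
    eval (Projectivization.mk ℂ v hv).rep F = 0 ↔ eval v F = 0 := by
  obtain ⟨a, ha, h⟩ := exists_rep_mk hv
  rw [h, eval_smul_of_isHomogeneous hF]
  simp [ha]

theorem subset_projClosure {n : ℕ} (X : Set (Fin n → ℂ)) : toProj '' X ⊆ projClosure X :=
  fun _ hp _ hZ => hZ.2 hp

theorem eval_eq_zero_of_mem_projClosure {n : ℕ} {X : Set (Fin n → ℂ)}
    {F : MvPolynomial (Fin (n + 1)) ℂ} {d : ℕ} (hF : F.IsHomogeneous d)
    (hX : ∀ x ∈ X, eval (Fin.cons 1 x : Fin (n + 1) → ℂ) F = 0)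
    {v : Fin (n + 1) → ℂ} (hv : v ≠ 0) (hvX : Projectivization.mk ℂ v hv ∈ projClosure X) :
    eval v F = 0 := by
  rw [← eval_rep_mk_eq_zero_iff hF hv]
  have := hvX {p | eval p.rep F = 0} ⟨⟨{F}, by simpa using ⟨d, hF⟩, by simp⟩, ?_⟩
  · exact this
  · rintro _ ⟨x, hx, rfl⟩
    exact (eval_rep_mk_eq_zero_iff hF _).2 (hX x hx)

theorem cons_mul_eq {n : ℕ} {v : Fin (n + 1) → ℂ} (hv : v 0 ≠ 0) :
    v = (Fin.cons (v 0) (fun i => (fun i : Fin n => v i.succ / v 0) i * v 0) :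
      Fin (n + 1) → ℂ) := by
  ext i
  refine Fin.cases ?_ (fun i => ?_) i
  · simp
  · simp [hv]

/-- The affine part of the projective closure of an affine variety is that variety. -/
theorem mem_of_mem_projClosure {n : ℕ} {X : Set (Fin n → ℂ)} (hreal : IsRealVariety X)
    {v : Fin (n + 1) → ℂ} (hv : v ≠ 0) (hvX : Projectivization.mk ℂ v hv ∈ projClosure X)
    (hv0 : v 0 ≠ 0) : (fun i => v (Fin.succ i) / v 0) ∈ X := by
  obtain ⟨I, rfl⟩ := hreal
  rw [mem_zeroLocus_iff]
  intro G hG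
  obtain ⟨F, hF, hFG⟩ := exists_homogenization G
  have h := eval_eq_zero_of_mem_projClosure (hF.map (algebraMap ℝ ℂ)) ?_ hv hvX
  · rw [eval_map, ← aeval_def, cons_mul_eq hv0, hFG] at h
    simpa [hv0] using h
  · intro x hx
    rw [eval_map, ← aeval_def]
    have := hFG ℂ x 1
    simp only [mul_one] at this
    rw [this, hx G hG, zero_mul]

/-! ### Linear Noether normalization of a cone -/

/-- No map from `R` to `R'` is given; instead `f` factors through the integral closure of `R'` in
`E`. -/
theorem isIntegralElem_trans {R R' E : Type*} [CommRing R] [CommRing R'] [CommRing E]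
    (f : R →+* E) (f' : R' →+* E) (h : ∀ a, f'.IsIntegralElem (f a)) {x : E}
    (hx : f.IsIntegralElem x) : f'.IsIntegralElem x := by
  let _ := f'.toAlgebra
  let g : R →+* integralClosure R' E := f.codRestrict (integralClosure R' E) h
  obtain ⟨p, hp, hpx⟩ := hx
  refine isIntegral_trans (R := R') (A := integralClosure R' E) x ⟨p.map g, hp.map g, ?_⟩
  rw [Polynomial.eval₂_map]
  exact hpx

theorem natDegree_coeff_prod_pow {σ Q : Type*} [CommRing Q] (a w : σ → Q) (m : σ → ℕ)
    (s : Finset σ) :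
    (∏ i ∈ s, (Polynomial.C (a i) + Polynomial.C (w i) * Polynomial.X) ^ m i).natDegree ≤
        ∑ i ∈ s, m i ∧
      (∏ i ∈ s, (Polynomial.C (a i) + Polynomial.C (w i) * Polynomial.X) ^ m i).coeff
        (∑ i ∈ s, m i) = ∏ i ∈ s, w i ^ m i := by
  classical
  have h1 : ∀ i, (Polynomial.C (a i) + Polynomial.C (w i) * Polynomial.X).natDegree ≤ 1 := by
    intro i
    rw [add_comm]
    exact Polynomial.natDegree_linear_le
  have hpow : ∀ i, ((Polynomial.C (a i) + Polynomial.C (w i) * Polynomial.X) ^ m i).natDegree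
      ≤ m i := by
    intro i
    simpa using Polynomial.natDegree_pow_le_of_le (m i) (h1 i)
  have hcoeff : ∀ i, ((Polynomial.C (a i) + Polynomial.C (w i) * Polynomial.X) ^ m i).coeff (m i)
      = w i ^ m i := by
    intro i
    have := Polynomial.coeff_pow_of_natDegree_le (m := m i) (h1 i)
    simpa using this
  induction s using Finset.induction_on with
  | empty => simp
  | insert i s hi ih =>
    simp only [Finset.prod_insert hi, Finset.sum_insert hi]
    refine ⟨Polynomial.natDegree_mul_le_of_le (hpow i) ih.1, ?_⟩
    rw [Polynomial.coeff_mul_add_eq_of_natDegree_le (hpow i) ih.1, hcoeff, ih.2]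

/-- Substituting affine linear polynomials in one variable into a homogeneous polynomial. -/
theorem natDegree_coeff_aeval_linear {σ k Q : Type*} [CommRing k] [CommRing Q] [Algebra k Q]
    {F : MvPolynomial σ k} {d : ℕ} (hF : F.IsHomogeneous d) (a w : σ → Q) :
    (aeval (fun i => Polynomial.C (a i) + Polynomial.C (w i) * Polynomial.X) F).natDegree ≤ d ∧
      (aeval (fun i => Polynomial.C (a i) + Polynomial.C (w i) * Polynomial.X) F).coeff d =
        aeval w F := by
  simp only [aeval_def, eval₂_eq, Polynomial.algebraMap_apply]
  have hd : ∀ m ∈ F.support, ∑ i ∈ m.support, m i = d := by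
    intro m hm
    rw [← Finsupp.degree_apply]
    by_contra h
    exact (mem_support_iff.1 hm) (hF.coeff_eq_zero h)
  constructor
  · refine Polynomial.natDegree_sum_le_of_forall_le _ _ fun m hm => ?_
    refine (Polynomial.natDegree_C_mul_le _ _).trans ?_
    rw [← hd m hm]
    exact (natDegree_coeff_prod_pow a w m _).1
  · rw [Polynomial.finsetSum_coeff]
    refine Finset.sum_congr rfl fun m hm => ?_
    rw [Polynomial.coeff_C_mul]
    congr 1
    rw [← (natDegree_coeff_prod_pow a w m _).2, hd m hm]

variable {B : Type} [CommRing B] [Algebra ℂ B]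

/-- The map from homogeneous coordinates `x₀, …, x_r` to `B[T]` given by `x₀ ↦ T` and
`x_{j+1} ↦ c_j T`. -/
def coneMap {r : ℕ} (c : Fin r → B) : MvPolynomial (Fin (r + 1)) ℂ →ₐ[ℂ] Polynomial B :=
  aeval fun i => Polynomial.C ((Fin.cons 1 c : Fin (r + 1) → B) i) * Polynomial.X

/-- The power of `T` records the degree, so the kernel is a homogeneous ideal. When the `c j`
generate the coordinate ring `B` of an affine variety, it is the ideal of the cone over the
projective closure. -/
theorem coneMap_eq_zero_iff {r : ℕ} (c : Fin r → B) (F : MvPolynomial (Fin (r + 1)) ℂ) :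
    coneMap c F = 0 ↔
      ∀ d, aeval (Fin.cons 1 c : Fin (r + 1) → B) (homogeneousComponent d F) = 0 := by
  rw [Polynomial.ext_iff]
  exact forall_congr' fun d => by rw [coneMap, coeff_aeval_C_mul_X, Polynomial.coeff_zero]

theorem coneMap_eq_zero_iff_of_isHomogeneous {r : ℕ} (c : Fin r → B)
    {F : MvPolynomial (Fin (r + 1)) ℂ} {d : ℕ} (hF : F.IsHomogeneous d) :
    coneMap c F = 0 ↔ aeval (Fin.cons 1 c : Fin (r + 1) → B) F = 0 := by
  rw [coneMap_eq_zero_iff]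
  constructor
  · intro h
    rw [← homogeneousComponent_eq_self hF]
    exact h d
  · intro h e
    by_cases hed : e = d
    · rw [hed, homogeneousComponent_eq_self hF, h]
    · rw [homogeneousComponent_of_mem hF, if_neg hed, map_zero]

theorem coneMap_X_zero {r : ℕ} (c : Fin r → B) : coneMap c (X 0) = Polynomial.X := by
  simp [coneMap]

theorem coneMap_X_succ {r : ℕ} (c : Fin r → B) (j : Fin r) :
    coneMap c (X j.succ) = Polynomial.C (c j) * Polynomial.X := by
  simp [coneMap]

theorem X_zero_dvd_of_eval_eq_zero {r : ℕ} {F : MvPolynomial (Fin (r + 1)) ℂ}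
    (h : ∀ w : Fin r → ℂ, eval (Fin.cons 0 w : Fin (r + 1) → ℂ) F = 0) : X 0 ∣ F := by
  have h0 : (finSuccEquiv ℂ r F).coeff 0 = 0 := by
    apply MvPolynomial.funext
    intro w
    have := h w
    rw [eval_eq_eval_mv_eval', ← Polynomial.coeff_zero_eq_eval_zero, Polynomial.coeff_map] at this
    simpa using this
  obtain ⟨g, hg⟩ := Polynomial.X_dvd_iff.2 h0
  refine ⟨(finSuccEquiv ℂ r).symm g, (finSuccEquiv ℂ r).injective ?_⟩
  rw [map_mul, hg, finSuccEquiv_X_zero, AlgEquiv.apply_symm_apply]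

/-- A homogeneous relation that does not vanish identically on `x₀ = 0`. -/
theorem exists_homogeneous_relation [IsDomain B] {r : ℕ} {c : Fin r → B}
    (hc : ¬ Function.Injective (coneMap c)) :
    ∃ (d : ℕ) (F : MvPolynomial (Fin (r + 1)) ℂ) (w : Fin r → ℂ), F.IsHomogeneous d ∧
      coneMap c F = 0 ∧ eval (Fin.cons 0 w : Fin (r + 1) → ℂ) F ≠ 0 := by
  by_contra! hno
  apply hc
  rw [injective_iff_map_eq_zero]
  have hall : ∀ F, coneMap c F = 0 → X 0 ∣ F := by
    intro F hF
    apply X_zero_dvd_of_eval_eq_zero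
    intro w
    rw [← sum_homogeneousComponent F, map_sum]
    refine Finset.sum_eq_zero fun d _ => hno d _ w (homogeneousComponent_isHomogeneous d F) ?_
    rw [coneMap_eq_zero_iff_of_isHomogeneous c (homogeneousComponent_isHomogeneous d F)]
    exact (coneMap_eq_zero_iff c F).1 hF d
  -- Infinite descent: `X 0` maps to the nonzerodivisor `T`, so dividing a relation by `X 0` leaves
  -- a relation of smaller degree.
  have hdesc : ∀ k, ∀ F, coneMap c F = 0 → F.totalDegree < k → F = 0 := by
    intro k
    induction k with
    | zero => intro F _ h; omega
    | succ k ih =>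
      intro F hF hk
      obtain ⟨G, rfl⟩ := hall F hF
      rw [map_mul, coneMap_X_zero, mul_eq_zero, or_iff_right Polynomial.X_ne_zero] at hF
      by_cases hG : G = 0
      · rw [hG, mul_zero]
      rw [totalDegree_mul_of_isDomain (X_ne_zero 0) hG, totalDegree_X] at hk
      exact absurd (ih G hF (by omega)) hG
  exact fun F hF => hdesc _ F hF (Nat.lt_succ_self _)

/-- As a polynomial in `x`, `F(a + w x)` has degree at most `d`, and its coefficient in degree `d`
is the nonzero constant `F(w)`; dividing by it gives a monic equation. -/
theorem isIntegralElem_of_relation {R E : Type*} [CommRing R] [Algebra ℂ R] [CommRing E]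
    [Algebra ℂ E] (f : R →ₐ[ℂ] E) {σ : Type*} {F : MvPolynomial σ ℂ} {d : ℕ}
    (hF : F.IsHomogeneous d) (a : σ → R) (w : σ → ℂ) (x : E)
    (hx : aeval (fun i => f (a i) + w i • x) F = 0) (hw : eval w F ≠ 0) :
    f.toRingHom.IsIntegralElem x := by
  obtain ⟨h1, h2⟩ := natDegree_coeff_aeval_linear hF a (fun i => algebraMap ℂ R (w i))
  set p := aeval (fun i => Polynomial.C (a i) + Polynomial.C (algebraMap ℂ R (w i)) *
    Polynomial.X) F with hp
  have h3 : aeval (fun i => algebraMap ℂ R (w i)) F = algebraMap ℂ R (eval w F) := by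
    have := aeval_algebraMap_apply R w F
    simp only [aeval_def (R := ℂ) (S₁ := ℂ), Algebra.algebraMap_self, eval₂_id] at this
    exact this
  refine ⟨Polynomial.C (algebraMap ℂ R (eval w F)⁻¹) * p, ?_, ?_⟩
  · refine Polynomial.monic_of_natDegree_le_of_coeff_eq_one d
      ((Polynomial.natDegree_C_mul_le _ _).trans h1) ?_
    rw [Polynomial.coeff_C_mul, h2, h3, ← map_mul, inv_mul_cancel₀ hw, map_one]
  · rw [Polynomial.eval₂_mul]
    have : Polynomial.eval₂ f.toRingHom x p = 0 := by
      let _ := f.toRingHom.toAlgebra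
      have : IsScalarTower ℂ R E := IsScalarTower.of_algebraMap_eq fun z => (f.commutes z).symm
      have e : Polynomial.eval₂ f.toRingHom x p = (Polynomial.aeval x).restrictScalars ℂ p := rfl
      rw [e, hp, MvPolynomial.comp_aeval_apply, ← hx]
      congr 1
      ext i
      simp only [Polynomial.aeval_X, map_add, map_mul, AlgHom.restrictScalars_apply,
        Polynomial.aeval_C, Algebra.smul_def, ← IsScalarTower.algebraMap_apply ℂ R E]
      rfl
    rw [this, mul_zero]

/-- If the coordinates satisfy a relation, one of them can be eliminated by a linear projection
keeping `T`. -/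
theorem exists_elimination [IsDomain B] {r : ℕ} {c : Fin r → B}
    (hc : ¬ Function.Injective (coneMap c)) :
    ∃ (s : ℕ) (c' : Fin s → B), s < r ∧ (∀ j, c' j ∈ Submodule.span ℂ (Set.range c)) ∧
      ∀ F, (coneMap c').toRingHom.IsIntegralElem (coneMap c F) := by
  obtain ⟨d, F, w, hF, hcF, hw⟩ := exists_homogeneous_relation hc
  -- If `w = 0`, then `F(0) ≠ 0` makes `F` a nonzero constant, which `coneMap c` cannot kill.
  obtain ⟨j₀, hj₀⟩ : ∃ j, w j ≠ 0 := by
    by_contra! h0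
    have hw0 : (Fin.cons 0 w : Fin (r + 1) → ℂ) = (0 : ℂ) • 0 := by
      ext i
      refine Fin.cases ?_ (fun j => ?_) i <;> simp [h0]
    rw [hw0, eval_smul_of_isHomogeneous hF] at hw
    have hd : d = 0 := by
      by_contra hd
      exact hw (by simp [hd])
    subst hd
    obtain ⟨z, rfl⟩ : ∃ z, F = C z := ⟨_, (totalDegree_eq_zero_iff_eq_C).1
      (Nat.le_zero.1 hF.totalDegree_le)⟩
    have : algebraMap ℂ (Polynomial B) z = 0 := by simpa [coneMap] using hcF
    rw [map_eq_zero] at this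
    simp [this] at hw
  obtain ⟨s, rfl⟩ : ∃ s, r = s + 1 := ⟨r - 1, by have := j₀.pos; omega⟩
  -- This is projection from the point `[0 : w]`, where `F` does not vanish: the old coordinates are
  -- `a + (0, w) • eT`, with `a` in the new ones. The leading `0` keeps `T` fixed.
  let e : B := (w j₀)⁻¹ • c j₀
  let c' : Fin s → B := fun j => c (j₀.succAbove j) - w (j₀.succAbove j) • e
  let a : Fin (s + 1 + 1) → MvPolynomial (Fin (s + 1)) ℂ :=
    Fin.cons (X 0) (j₀.insertNth 0 fun j => X j.succ)
  have ha : ∀ i, coneMap c' (a i) + (Fin.cons 0 w : Fin (s + 1 + 1) → ℂ) i •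
      (Polynomial.C e * Polynomial.X) =
      Polynomial.C ((Fin.cons 1 c : Fin (s + 1 + 1) → B) i) * Polynomial.X := by
    intro i
    refine Fin.cases ?_ (fun j => ?_) i
    · simp [a, coneMap_X_zero]
    · refine Fin.succAboveCases j₀ ?_ (fun k => ?_) j
      · simp [a, e, ← smul_mul_assoc, Polynomial.smul_C, smul_smul, hj₀]
      · simp only [a, Fin.cons_succ, Fin.insertNth_apply_succAbove, coneMap_X_succ, c']
        rw [← smul_mul_assoc, Polynomial.smul_C, ← add_mul, ← Polynomial.C_add, sub_add_cancel]
  have he : (coneMap c').toRingHom.IsIntegralElem (Polynomial.C e * Polynomial.X) := by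
    refine isIntegralElem_of_relation (coneMap c') hF a (Fin.cons 0 w) _ ?_ hw
    simp only [ha]
    exact hcF
  refine ⟨s, c', Nat.lt_succ_self s, fun j => ?_, fun G => ?_⟩
  · exact Submodule.sub_mem _ (Submodule.subset_span ⟨_, rfl⟩)
      (Submodule.smul_mem _ _ (Submodule.smul_mem _ _ (Submodule.subset_span ⟨_, rfl⟩)))
  · have hC : ∀ z : ℂ, (coneMap c').toRingHom.IsIntegralElem (algebraMap ℂ (Polynomial B) z) := by
      intro z
      rw [← (coneMap c').commutes z]
      exact RingHom.isIntegralElem_map (coneMap c').toRingHom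
    induction G using MvPolynomial.induction_on with
    | C z =>
      rw [← algebraMap_eq, AlgHom.commutes]
      exact hC z
    | add p q hp hq =>
      rw [map_add]
      exact hp.add _ hq
    | mul_X p i hp =>
      rw [map_mul]
      refine hp.mul _ ?_
      have : coneMap c (X i) = Polynomial.C ((Fin.cons 1 c : Fin (s + 1 + 1) → B) i) *
        Polynomial.X := by simp [coneMap]
      rw [this, ← ha i, Algebra.smul_def]
      exact (RingHom.isIntegralElem_map (coneMap c').toRingHom).add _ ((hC _).mul _ he)

/-- Linear Noether normalization of the cone over an affine variety, with the cone coordinate `T`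
among the parameters. -/
theorem exists_linear_noether_normalization [IsDomain B] {n : ℕ} (b : Fin n → B) :
    ∃ (r : ℕ) (c : Fin r → B), (∀ j, c j ∈ Submodule.span ℂ (Set.range b)) ∧
      Function.Injective (coneMap c) ∧
      ∀ F, (coneMap c).toRingHom.IsIntegralElem (coneMap b F) := by
  suffices h : ∀ (r : ℕ) (c : Fin r → B), (∀ j, c j ∈ Submodule.span ℂ (Set.range b)) →
      (∀ F, (coneMap c).toRingHom.IsIntegralElem (coneMap b F)) →
      ∃ (r : ℕ) (c : Fin r → B), (∀ j, c j ∈ Submodule.span ℂ (Set.range b)) ∧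
        Function.Injective (coneMap c) ∧
        ∀ F, (coneMap c).toRingHom.IsIntegralElem (coneMap b F) from
    h n b (fun j => Submodule.subset_span ⟨j, rfl⟩)
      fun F => RingHom.isIntegralElem_map (coneMap b).toRingHom
  intro r
  induction r using Nat.strong_induction_on with
  | _ r ih =>
    intro c hcb hint
    by_cases hc : Function.Injective (coneMap c)
    · exact ⟨r, c, hcb, hc, hint⟩
    obtain ⟨s, c', hs, hc', hint'⟩ := exists_elimination hc
    refine ih s hs c' (fun j => ?_) fun F => isIntegralElem_trans _ _ hint' (hint F)
    refine Submodule.span_le.2 ?_ (hc' j)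
    rintro _ ⟨i, rfl⟩
    exact hcb i

/-! ### Openness of finite maps to affine space -/

/-- `|P(z)|` is the product of the distances from `z` to the roots, hence at least the smallest of
them to the power `deg P`. -/
theorem exists_root_near {P : Polynomial ℂ} (hP : P.Monic) (hd : P.natDegree ≠ 0) (z : ℂ) :
    ∃ a, P.IsRoot a ∧ ‖z - a‖ ^ P.natDegree ≤ ‖P.eval z‖ := by
  have hsp : P.Splits := IsAlgClosed.splits P
  have hcard : P.roots.card = P.natDegree := hsp.natDegree_eq_card_roots.symm
  have hne : P.roots.toFinset.Nonempty := by
    rw [Multiset.toFinset_nonempty]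
    intro h
    rw [h] at hcard
    exact hd hcard.symm
  obtain ⟨a, ha, hmin⟩ := P.roots.toFinset.exists_min_image (fun a => ‖z - a‖) hne
  refine ⟨a, ((Polynomial.mem_roots hP.ne_zero).1 (Multiset.mem_toFinset.1 ha)), ?_⟩
  have e : ‖P.eval z‖ = (P.roots.map fun a => ‖z - a‖).prod := by
    conv_lhs => rw [hsp.eq_prod_roots_of_monic hP]
    rw [Polynomial.eval_multiset_prod, Multiset.map_map]
    have := map_multiset_prod (normHom : ℂ →*₀ ℝ)
      (P.roots.map ((fun p => Polynomial.eval z p) ∘ fun a => Polynomial.X - Polynomial.C a))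
    rw [Multiset.map_map] at this
    simpa [Function.comp_def] using this
  rw [e, ← hcard]
  have key : ∀ s : Multiset ℂ, (∀ b ∈ s, ‖z - a‖ ≤ ‖z - b‖) →
      ‖z - a‖ ^ s.card ≤ (s.map fun a => ‖z - a‖).prod := by
    intro s
    induction s using Multiset.induction_on with
    | empty => simp
    | cons b s ih =>
      intro h
      rw [Multiset.card_cons, Multiset.map_cons, Multiset.prod_cons, pow_succ']
      exact mul_le_mul (h b (Multiset.mem_cons_self b s))
        (ih fun x hx => h x (Multiset.mem_cons_of_mem hx)) (by positivity) (norm_nonneg _)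
  exact key _ fun b hb => hmin b (Multiset.mem_toFinset.2 hb)

/-- Cauchy's bound, with the maximum weakened to a sum so that continuity in the coefficients is
plain. -/
theorem norm_le_of_isRoot_of_monic {P : Polynomial ℂ} (hP : P.Monic) {z : ℂ} (hz : P.IsRoot z) :
    ‖z‖ ≤ (∑ k ∈ Finset.range P.natDegree, ‖P.coeff k‖) + 1 := by
  refine (NNReal.coe_le_coe.2 (hz.norm_lt_cauchyBound hP.ne_zero).le).trans ?_
  rw [Polynomial.cauchyBound, hP.leadingCoeff, nnnorm_one, div_one, NNReal.coe_add, NNReal.coe_one]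
  have : (Finset.range P.natDegree).sup (fun k => ‖P.coeff k‖₊) ≤
      ∑ k ∈ Finset.range P.natDegree, ‖P.coeff k‖₊ :=
    Finset.sup_le fun k hk => Finset.single_le_sum (f := fun k => ‖P.coeff k‖₊)
      (fun _ _ => zero_le) hk
  have := NNReal.coe_le_coe.2 this
  push_cast at this
  simpa using this

section

variable {N r : ℕ} {D : Type} [CommRing D] [Algebra ℂ D]
  (φ : MvPolynomial (Fin N) ℂ →ₐ[ℂ] D) (ψ : MvPolynomial (Fin r) ℂ →ₐ[ℂ] MvPolynomial (Fin N) ℂ)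

/-- The points of affine space at which the kernel of `φ` vanishes. -/
def kerLocus : Set (Fin N → ℂ) := {p | ∀ F, φ F = 0 → eval p F = 0}

/-- The map of affine spaces given by an algebra homomorphism of polynomial rings. -/
def polyMap (p : Fin N → ℂ) : Fin r → ℂ := fun j => eval p (ψ (X j))

theorem eval_polyMap (p : Fin N → ℂ) (G : MvPolynomial (Fin r) ℂ) :
    eval (polyMap ψ p) G = eval p (ψ G) := by
  induction G using MvPolynomial.induction_on with
  | C z => rw [← algebraMap_eq, AlgHom.commutes]; simp
  | add p q hp hq => simp [hp, hq]
  | mul_X p i hp => simp [hp, polyMap]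

theorem continuous_polyMap : Continuous (polyMap ψ) :=
  continuous_pi fun j => MvPolynomial.continuous_eval (ψ (X j))

theorem isClosed_kerLocus : IsClosed (kerLocus φ) := by
  have : kerLocus φ = ⋂ F, ⋂ (_ : φ F = 0), {p | eval p F = 0} := by
    ext p; simp [kerLocus]
  rw [this]
  exact isClosed_iInter fun F => isClosed_iInter fun _ =>
    isClosed_eq (MvPolynomial.continuous_eval F) continuous_const

theorem eval₂_eq_zero_of_mem_kerLocus {f : MvPolynomial (Fin N) ℂ}
    {m : Polynomial (MvPolynomial (Fin r) ℂ)}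
    (hm : m.eval₂ (φ.comp ψ).toRingHom (φ f) = 0) {p : Fin N → ℂ} (hp : p ∈ kerLocus φ) :
    m.eval₂ (eval (polyMap ψ p)) (eval p f) = 0 := by
  have h1 : m.eval₂ (φ.comp ψ).toRingHom (φ f) = φ (m.eval₂ ψ.toRingHom f) := by
    exact (Polynomial.hom_eval₂ m ψ.toRingHom φ.toRingHom f).symm
  rw [h1] at hm
  have h2 := hp _ hm
  rw [Polynomial.hom_eval₂] at h2
  have e : (eval p).comp ψ.toRingHom = eval (polyMap ψ p) :=
    RingHom.ext fun G => (eval_polyMap ψ p G).symm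
  rwa [e] at h2

variable {φ ψ} in
/-- The values of a function on the fibres of a finite map to affine space are exactly the roots of
a monic polynomial whose coefficients are functions on the base. -/
theorem exists_monic_forall_root_lifts [IsDomain D] (hφ : Function.Surjective φ)
    (hinj : Function.Injective (φ.comp ψ))
    (hint : ∀ x, (φ.comp ψ).toRingHom.IsIntegralElem x) (f : MvPolynomial (Fin N) ℂ) :
    ∃ m : Polynomial (MvPolynomial (Fin r) ℂ), m.Monic ∧
      m.eval₂ (φ.comp ψ).toRingHom (φ f) = 0 ∧
      ∀ (q : Fin r → ℂ) (α : ℂ), m.eval₂ (eval q) α = 0 →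
        ∃ p ∈ kerLocus φ, polyMap ψ p = q ∧ eval p f = α := by
  let _ := (φ.comp ψ).toRingHom.toAlgebra
  have hI : IsIntegral (MvPolynomial (Fin r) ℂ) (φ f) := hint (φ f)
  have : Module.IsTorsionFree (MvPolynomial (Fin r) ℂ) D :=
    Module.isTorsionFree_iff_algebraMap_injective.2 hinj
  refine ⟨minpoly (MvPolynomial (Fin r) ℂ) (φ f), minpoly.monic hI,
    minpoly.aeval (MvPolynomial (Fin r) ℂ) (φ f), fun q α hroot => ?_⟩
  -- The pair `(q, α)` is a maximal ideal of `ℂ[x][Y]`, over which `D` is integral through `Y ↦ φ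
  -- f`. Lying over and the Nullstellensatz turn it into the point `p`, once `ker h ≤ ker g` is
  -- known.
  let g : Polynomial (MvPolynomial (Fin r) ℂ) →+* ℂ := Polynomial.eval₂RingHom (eval q) α
  have hg : Function.Surjective g := fun z => ⟨Polynomial.C (C z), by simp [g]⟩
  have hmax : (RingHom.ker g).IsMaximal := RingHom.ker_isMaximal_of_surjective g hg
  let h : Polynomial (MvPolynomial (Fin r) ℂ) →+* D :=
    Polynomial.eval₂RingHom (φ.comp ψ).toRingHom (φ f)
  obtain ⟨Q, hQ, hQg⟩ : ∃ Q : Ideal D, Q.IsMaximal ∧ Q.comap h = RingHom.ker g := by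
    let _ := h.toAlgebra
    have : Algebra.IsIntegral (Polynomial (MvPolynomial (Fin r) ℂ)) D := ⟨fun x => by
      refine RingHom.IsIntegralElem.of_comp (f := Polynomial.C) (g := h) ?_
      have e : h.comp Polynomial.C = (φ.comp ψ).toRingHom := by ext <;> simp [h]
      rw [e]
      exact hint x⟩
    refine Ideal.exists_ideal_over_maximal_of_isIntegral (RingHom.ker g) ?_
    intro P hP
    have hP' : Polynomial.aeval (φ f) P = 0 := hP
    -- Since the polynomial ring is integrally closed, every polynomial killing `φ f` is a multiple
    -- of the minimal one, which vanishes at `(q, α)`.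
    obtain ⟨P', rfl⟩ := minpoly.isIntegrallyClosed_dvd hI hP'
    rw [RingHom.mem_ker, map_mul]
    have : g (minpoly (MvPolynomial (Fin r) ℂ) (φ f)) = 0 := hroot
    rw [this, zero_mul]
  have hQmax : (Q.comap φ.toRingHom).IsMaximal :=
    Ideal.comap_isMaximal_of_surjective φ.toRingHom hφ
  obtain ⟨p, hp⟩ := isMaximal_iff_eq_vanishingIdeal_singleton.1 hQmax
  have hpQ : ∀ F, φ F ∈ Q → eval p F = 0 := by
    intro F hF
    have : F ∈ vanishingIdeal ℂ {p} := hp ▸ hF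
    rw [mem_vanishingIdeal_singleton_iff] at this
    simpa [aeval_def] using this
  have hgQ : ∀ P, g P = 0 → h P ∈ Q := by
    intro P hP
    have : P ∈ Q.comap h := hQg ▸ hP
    exact this
  refine ⟨p, fun F hF => hpQ F (hF ▸ Q.zero_mem), ?_, ?_⟩
  · ext j
    have h1 := hgQ (Polynomial.C (X j - C (q j))) (by simp [g])
    have h2 : h (Polynomial.C (X j - C (q j))) = φ (ψ (X j - C (q j))) := by simp [h]
    rw [h2] at h1
    have h3 := hpQ _ h1
    rw [← eval_polyMap] at h3
    simpa [sub_eq_zero] using h3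
  · have h1 := hgQ (Polynomial.X - Polynomial.C (C α)) (by simp [g])
    have h2 : h (Polynomial.X - Polynomial.C (C α)) = φ (f - ψ (C α)) := by simp [h]
    rw [h2] at h1
    have h3 := hpQ _ h1
    rw [map_sub, ← eval_polyMap] at h3
    simpa [sub_eq_zero] using h3

variable {φ ψ} in
/-- Finite maps to affine space are bounded over bounded sets and have finite fibres. -/
theorem finite_fibre_and_bound
    (hint : ∀ x, (φ.comp ψ).toRingHom.IsIntegralElem x) :
    (∀ q, {p | p ∈ kerLocus φ ∧ polyMap ψ p = q}.Finite) ∧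
      ∃ β : (Fin r → ℂ) → ℝ, Continuous β ∧ ∀ p ∈ kerLocus φ, ‖p‖ ≤ β (polyMap ψ p) := by
  -- Each coordinate of `p` is a root of a monic polynomial that depends only on the image of `p`.
  choose m hm hm0 using fun i => hint (φ (X i))
  have hroot : ∀ p ∈ kerLocus φ, ∀ i, ((m i).map (eval (polyMap ψ p))).IsRoot (p i) := by
    intro p hp i
    have := eval₂_eq_zero_of_mem_kerLocus φ ψ (hm0 i) hp
    rwa [eval_X, ← Polynomial.eval_map] at this
  constructor
  · intro q
    refine (Set.Finite.pi (t := fun i => {z | ((m i).map (eval q)).IsRoot z}) fun i =>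
      Polynomial.finite_setOfPred_isRoot ((hm i).map _).ne_zero).subset ?_
    rintro p ⟨hp, rfl⟩ i _
    exact hroot p hp i
  · refine ⟨fun q => ∑ i, ((∑ k ∈ Finset.range (m i).natDegree, ‖eval q ((m i).coeff k)‖) + 1),
      ?_, fun p hp => ?_⟩
    · refine continuous_finsetSum _ fun i _ => Continuous.add ?_ continuous_const
      exact continuous_finsetSum _ fun k _ => (MvPolynomial.continuous_eval _).norm
    · have hnn : ∀ i, 0 ≤ (∑ k ∈ Finset.range (m i).natDegree,
          ‖eval (polyMap ψ p) ((m i).coeff k)‖) + 1 := fun i => by positivity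
      refine (pi_norm_le_iff_of_nonneg (Finset.sum_nonneg fun i _ => hnn i)).2 fun i => ?_
      refine le_trans ?_ (Finset.single_le_sum (fun i _ => hnn i) (Finset.mem_univ i))
      have := norm_le_of_isRoot_of_monic ((hm i).map (eval (polyMap ψ p))) (hroot p hp i)
      simpa [(hm i).natDegree_map] using this

theorem exists_eval_separates {s : Set (Fin N → ℂ)} (hs : s.Finite) (p : Fin N → ℂ) :
    ∃ f : MvPolynomial (Fin N) ℂ, eval p f ≠ 0 ∧ ∀ p' ∈ s, eval p' f ≠ 0 → p' = p := by
  classical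
  have h : ∀ p' : Fin N → ℂ, ∃ f : MvPolynomial (Fin N) ℂ, eval p f ≠ 0 ∧
      (eval p' f ≠ 0 → p' = p) := by
    intro p'
    by_cases hp : p' = p
    · exact ⟨1, by simp, fun _ => hp⟩
    obtain ⟨i, hi⟩ := Function.ne_iff.1 hp
    exact ⟨X i - C (p' i), by simpa [sub_eq_zero] using Ne.symm hi, by simp⟩
  choose f hf hf' using h
  refine ⟨∏ p' ∈ hs.toFinset, f p', ?_, fun p' hp' hne => hf' p' ?_⟩
  · rw [map_prod]
    exact Finset.prod_ne_zero_iff.2 fun p' _ => hf p'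
  · rw [map_prod] at hne
    exact Finset.prod_ne_zero_iff.1 hne p' (hs.mem_toFinset.2 hp')

variable {φ ψ} in
/-- A finite map from an irreducible affine variety onto affine space is open in the Euclidean
topology. -/
theorem eventually_exists_preimage_mem [IsDomain D] (hφ : Function.Surjective φ)
    (hinj : Function.Injective (φ.comp ψ))
    (hint : ∀ x, (φ.comp ψ).toRingHom.IsIntegralElem x) {p : Fin N → ℂ} (hp : p ∈ kerLocus φ)
    {U : Set (Fin N → ℂ)} (hU : U ∈ nhds p) :
    ∀ᶠ q in nhds (polyMap ψ p), ∃ p' ∈ kerLocus φ, polyMap ψ p' = q ∧ p' ∈ U := by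
  by_contra hcon
  -- Suppose `q k` tends to the image of `p` with no preimage in `U`. Choose `f` separating `p` from
  -- the rest of its fibre. Roots `α k` of the monic polynomial over `q k` tend to `f(p)` and lift
  -- to points `p' k`. These are bounded, and any limit lies in the fibre of `p` with value `f(p)`,
  -- so it is `p`.
  obtain ⟨q, hq, hqU⟩ := Filter.exists_seq_forall_of_frequently (Filter.not_eventually.1 hcon)
  obtain ⟨hfin, β, hβ, hbound⟩ := finite_fibre_and_bound hint
  obtain ⟨f, hf, hfsep⟩ := exists_eval_separates (hfin (polyMap ψ p)) p
  obtain ⟨m, hm, hmf, hlift⟩ := exists_monic_forall_root_lifts hφ hinj hint f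
  have hroot := eval₂_eq_zero_of_mem_kerLocus φ ψ hmf hp
  have hdeg : m.natDegree ≠ 0 := by
    intro h0
    rw [Polynomial.eq_one_of_monic_natDegree_zero hm h0] at hroot
    simp at hroot
  have hnear : ∀ k, ∃ α, m.eval₂ (eval (q k)) α = 0 ∧
      ‖eval p f - α‖ ^ m.natDegree ≤ ‖m.eval₂ (eval (q k)) (eval p f)‖ := by
    intro k
    have := exists_root_near (hm.map (eval (q k)))
      (by rwa [hm.natDegree_map]) (eval p f)
    simpa only [hm.natDegree_map, Polynomial.IsRoot, Polynomial.eval_map] using this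
  choose α hα hαnear using hnear
  have hcont : Continuous fun q => m.eval₂ (eval q) (eval p f) := by
    simp only [Polynomial.eval₂_eq_sum_range]
    exact continuous_finsetSum _ fun k _ =>
      (MvPolynomial.continuous_eval _).mul continuous_const
  have hαlim : Filter.Tendsto α Filter.atTop (nhds (eval p f)) := by
    have h1 : Filter.Tendsto (fun k => ‖m.eval₂ (eval (q k)) (eval p f)‖) Filter.atTop
        (nhds 0) := by
      have := ((hcont.tendsto _).comp hq).norm
      rwa [hroot, norm_zero] at this
    have h2 := squeeze_zero (fun k => by positivity) hαnear h1
    rw [tendsto_iff_norm_sub_tendsto_zero]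
    rw [Metric.tendsto_atTop] at h2 ⊢
    intro ε hε
    obtain ⟨K, hK⟩ := h2 (ε ^ m.natDegree) (by positivity)
    refine ⟨K, fun k hk => ?_⟩
    have := hK k hk
    rw [Real.dist_eq, sub_zero, abs_of_nonneg (by positivity)] at this ⊢
    rw [norm_sub_rev]
    exact lt_of_pow_lt_pow_left₀ _ hε.le this
  choose p' hp'V hp'q hp'f using fun k => hlift (q k) (α k) (hα k)
  obtain ⟨R, hR⟩ := (Metric.isBounded_range_of_tendsto _ ((hβ.tendsto _).comp hq)).exists_norm_le
  have hp'R : ∀ k, p' k ∈ Metric.closedBall (0 : Fin N → ℂ) R := by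
    intro k
    rw [mem_closedBall_zero_iff]
    refine (hbound _ (hp'V k)).trans ((le_abs_self _).trans ?_)
    rw [hp'q]
    exact hR _ ⟨k, rfl⟩
  obtain ⟨a, -, σ, hσ, hlim⟩ := tendsto_subseq_of_bounded Metric.isBounded_closedBall hp'R
  have haV : a ∈ kerLocus φ :=
    (isClosed_kerLocus φ).mem_of_tendsto hlim (Filter.Eventually.of_forall fun k => hp'V (σ k))
  have haq : polyMap ψ a = polyMap ψ p := by
    refine tendsto_nhds_unique (((continuous_polyMap ψ).tendsto a).comp hlim) ?_
    have : polyMap ψ ∘ p' ∘ σ = q ∘ σ := by ext1 k; simp [hp'q]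
    rw [this]
    exact hq.comp hσ.tendsto_atTop
  have haf : eval a f = eval p f := by
    refine tendsto_nhds_unique (((MvPolynomial.continuous_eval f).tendsto a).comp hlim) ?_
    have : (fun x => eval x f) ∘ p' ∘ σ = α ∘ σ := by ext1 k; simp [hp'f]
    rw [this]
    exact hαlim.comp hσ.tendsto_atTop
  have hap : a = p := hfsep a ⟨haV, haq⟩ (haf ▸ hf)
  rw [hap] at hlim
  obtain ⟨k, hk⟩ := (hlim.eventually hU).exists
  exact hqU (σ k) ⟨p' (σ k), hp'V _, hp'q _, hk⟩

end

/-! ### Points at infinity -/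

/-- A point at infinity of the projective closure lies at infinity on the closure of an irreducible
component. -/
theorem exists_prime_mem_kerLocus_coneMap {n : ℕ} {X : Set (Fin n → ℂ)}
    {v : Fin (n + 1) → ℂ} (hv : v ≠ 0) (hvX : Projectivization.mk ℂ v hv ∈ projClosure X) :
    ∃ P : Ideal (MvPolynomial (Fin n) ℂ), P.IsPrime ∧ vanishingIdeal ℂ X ≤ P ∧
      v ∈ kerLocus (coneMap fun i => Ideal.Quotient.mk P (MvPolynomial.X i)) := by
  by_contra! hcon
  have hfin := (vanishingIdeal ℂ X).finite_minimalPrimes_of_isNoetherianRing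
  -- Otherwise each minimal prime `P` has a homogeneous `F P`, nonzero at `v`, whose
  -- dehomogenization lies in `P`. The product dehomogenizes into the radical of the vanishing
  -- ideal, so it vanishes on `X` and therefore at `v`, a contradiction.
  have hF : ∀ P : (vanishingIdeal ℂ X).minimalPrimes, ∃ (d : ℕ) (F : MvPolynomial (Fin (n + 1)) ℂ),
      F.IsHomogeneous d ∧ eval v F ≠ 0 ∧
      aeval (Fin.cons 1 MvPolynomial.X : Fin (n + 1) → MvPolynomial (Fin n) ℂ) F ∈ P.1 := by
    rintro ⟨P, hP⟩
    have h := hcon P hP.1.1 hP.1.2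
    simp only [kerLocus, Set.mem_ofPred_eq, not_forall] at h
    obtain ⟨F, hF0, hFv⟩ := h
    rw [← sum_homogeneousComponent F, map_sum] at hFv
    obtain ⟨d, -, hd⟩ := Finset.exists_ne_zero_of_sum_ne_zero hFv
    refine ⟨d, _, homogeneousComponent_isHomogeneous d F, hd, ?_⟩
    rw [← Ideal.Quotient.eq_zero_iff_mem]
    have h1 := (coneMap_eq_zero_iff _ F).1 hF0 d
    rw [← h1]
    change Ideal.Quotient.mkₐ ℂ P _ = _
    rw [MvPolynomial.comp_aeval_apply]
    congr 2
    ext i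
    refine Fin.cases ?_ (fun j => ?_) i
    · simp
    · simp
  choose d F hFd hFv hFP using hF
  have := hfin.fintype
  have hprod := IsHomogeneous.prod Finset.univ F d fun P _ => hFd P
  refine Finset.prod_ne_zero_iff.2 (fun P _ => hFv P) ((map_prod (eval v) F Finset.univ).symm.trans
    (eval_eq_zero_of_mem_projClosure hprod (fun x hx => ?_) hv hvX))
  have hmem : aeval (Fin.cons 1 MvPolynomial.X : Fin (n + 1) → MvPolynomial (Fin n) ℂ) (∏ P, F P) ∈
      (vanishingIdeal ℂ X).radical := by
    rw [← Ideal.sInf_minimalPrimes, Submodule.mem_sInf]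
    intro P hP
    rw [map_prod, ← Finset.mul_prod_erase _ _ (Finset.mem_univ (⟨P, hP⟩ :
      (vanishingIdeal ℂ X).minimalPrimes))]
    exact Ideal.mul_mem_right _ P (hFP ⟨P, hP⟩)
  obtain ⟨k, hk⟩ := hmem
  have h2 := hk x hx
  rw [map_pow] at h2
  have h3 := eq_zero_of_pow_eq_zero h2
  rw [MvPolynomial.comp_aeval_apply] at h3
  rw [← h3, aeval_def, Algebra.algebraMap_self, ← eval₂_id]
  congr 1
  ext i
  refine Fin.cases ?_ (fun j => ?_) i
  · simp
  · simp

theorem div_mem_zeroLocus_of_mem_kerLocus_coneMap {n : ℕ} {P : Ideal (MvPolynomial (Fin n) ℂ)}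
    {v : Fin (n + 1) → ℂ} (hv : v ∈ kerLocus (coneMap fun i => Ideal.Quotient.mk P (MvPolynomial.X i)))
    (hv0 : v 0 ≠ 0) : (fun i => v (Fin.succ i) / v 0) ∈ zeroLocus ℂ P := by
  intro G hG
  obtain ⟨F, hF, hFG⟩ := exists_homogenization G
  have h0 : coneMap (fun i => Ideal.Quotient.mk P (MvPolynomial.X i)) F = 0 := by
    rw [coneMap_eq_zero_iff_of_isHomogeneous _ hF]
    have := hFG (MvPolynomial (Fin n) ℂ ⧸ P) (fun i => Ideal.Quotient.mk P (MvPolynomial.X i)) 1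
    simp only [mul_one] at this
    rw [this]
    have e : aeval (fun i => Ideal.Quotient.mk P (MvPolynomial.X i)) G = Ideal.Quotient.mkₐ ℂ P (aeval MvPolynomial.X G) := by
      rw [MvPolynomial.comp_aeval_apply]; rfl
    rw [e, aeval_X_left_apply, Ideal.Quotient.mkₐ_eq_mk, Ideal.Quotient.eq_zero_iff_mem.2 hG,
      zero_mul]
  have h := hv F h0
  have h1 := hFG ℂ (fun i => v i.succ / v 0) (v 0)
  rw [← cons_mul_eq hv0, aeval_def, Algebra.algebraMap_self, eval₂_id, h] at h1
  exact (mul_eq_zero.1 h1.symm).resolve_right (pow_ne_zero _ hv0)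

/-- The lift uses linear forms in `x₁, …, xₙ`; `ψ (X 0) = X 0` makes the projection of cones
preserve the coordinate `x₀`. -/
theorem exists_linear_lift {B : Type} [CommRing B] [Algebra ℂ B] {n r : ℕ} {b : Fin n → B}
    {c : Fin r → B} (hcb : ∀ j, c j ∈ Submodule.span ℂ (Set.range b)) :
    ∃ ψ : MvPolynomial (Fin (r + 1)) ℂ →ₐ[ℂ] MvPolynomial (Fin (n + 1)) ℂ,
      (coneMap b).comp ψ = coneMap c ∧ ψ (X 0) = X 0 := by
  choose M hM using fun j => (Submodule.mem_span_range_iff_exists_fun ℂ).1 (hcb j)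
  refine ⟨aeval (Fin.cons (X 0) fun j => ∑ i, M j i • X i.succ), ?_, by simp⟩
  ext1 i
  refine Fin.cases ?_ (fun j => ?_) i
  · simp [coneMap_X_zero]
  · simp only [AlgHom.comp_apply, aeval_X, Fin.cons_succ, map_sum, map_smul, coneMap_X_succ]
    rw [← hM j, map_sum, Finset.sum_mul]
    simp [← Polynomial.smul_C]

/-- The cone coordinate takes positive real values near each of its zeros. -/
theorem exists_pos_mem_kerLocus_coneMap {B : Type} [CommRing B] [IsDomain B] [Algebra ℂ B] {n : ℕ}
    (b : Fin n → B) {v : Fin (n + 1) → ℂ} (hv : v ∈ kerLocus (coneMap b)) (hv0 : v 0 = 0)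
    {U : Set (Fin (n + 1) → ℂ)} (hU : U ∈ nhds v) :
    ∃ t : ℝ, 0 < t ∧ ∃ p ∈ kerLocus (coneMap b), p 0 = t ∧ p ∈ U := by
  obtain ⟨r, c, hcb, hinj, hint⟩ := exists_linear_noether_normalization b
  obtain ⟨ψ, hψ, hψ0⟩ := exists_linear_lift hcb
  -- The range of `coneMap b` is a domain onto which `φ` is surjective, as the openness theorem
  -- requires.
  let φ : MvPolynomial (Fin (n + 1)) ℂ →ₐ[ℂ] (coneMap b).range := (coneMap b).rangeRestrict
  have hφψ : (coneMap b).range.val.toRingHom.comp (φ.comp ψ).toRingHom =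
      (coneMap c).toRingHom := by
    rw [← hψ]; rfl
  have hker : kerLocus φ = kerLocus (coneMap b) := by
    have : ∀ F, φ F = 0 ↔ coneMap b F = 0 := fun F => Subtype.ext_iff
    simp only [kerLocus, this]
  have hφinj : Function.Injective (φ.comp ψ) := fun F G h => hinj (by
    have h1 := RingHom.congr_fun hφψ F
    have h2 := RingHom.congr_fun hφψ G
    exact h1.symm.trans ((congrArg (coneMap b).range.val h).trans h2))
  have hφint : ∀ x, (φ.comp ψ).toRingHom.IsIntegralElem x := by
    rintro ⟨x, F, rfl⟩
    refine RingHom.IsIntegralElem.of_map (g := (coneMap b).range.val.toRingHom)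
      Subtype.val_injective ?_
    rw [hφψ]
    exact hint F
  have hev := eventually_exists_preimage_mem (φ := φ) (ψ := ψ)
    (coneMap b).rangeRestrict_surjective hφinj hφint (p := v) (hker ▸ hv) hU
  -- A real path through the image of `v` that moves only the coordinate `x₀`, starting from `v 0 =
  -- 0`.
  let q : ℝ → Fin (r + 1) → ℂ := fun t => Function.update (polyMap ψ v) 0 (t : ℂ)
  have hpoly0 : ∀ w, polyMap ψ w 0 = w 0 := fun w => by simp [polyMap, hψ0]
  have hq0 : q 0 = polyMap ψ v := by
    simp only [q, Complex.ofReal_zero]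
    rw [← hv0, ← hpoly0 v, Function.update_eq_self]
  have hq : Continuous q := continuous_const.update 0 Complex.continuous_ofReal
  rw [← hq0] at hev
  have hev' := (hq.tendsto 0).eventually hev
  obtain ⟨t, ⟨p, hp, hpq, hpU⟩, ht⟩ :=
    ((hev'.filter_mono nhdsWithin_le_nhds).and (self_mem_nhdsWithin (s := Set.Ioi (0 : ℝ)))).exists
  refine ⟨t, ht, p, hker ▸ hp, ?_, hpU⟩
  rw [← hpoly0 p, hpq]
  exact Function.update_self ..

/-- Every point at infinity of the projective closure is a limit of positive rescalings of points of
the affine variety. -/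
theorem exists_pos_smul_mem_of_mem_projClosure {n : ℕ} {X : Set (Fin n → ℂ)}
    (hreal : IsRealVariety X) {v : Fin (n + 1) → ℂ} (hv : v ≠ 0)
    (hvX : Projectivization.mk ℂ v hv ∈ projClosure X) (hv0 : v 0 = 0)
    {U : Set (Fin n → ℂ)} (hU : U ∈ nhds (fun i => v (Fin.succ i))) :
    ∃ t : ℝ, 0 < t ∧ ∃ x ∈ X, (t : ℂ) • x ∈ U := by
  obtain ⟨P, hP, hXP, hvP⟩ := exists_prime_mem_kerLocus_coneMap hv hvX
  have hcont : Continuous fun (w : Fin (n + 1) → ℂ) (i : Fin n) => w i.succ := by fun_prop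
  obtain ⟨t, ht, p, hp, hp0, hpU⟩ :=
    exists_pos_mem_kerLocus_coneMap _ hvP hv0 (hcont.continuousAt hU)
  have ht' : (t : ℂ) ≠ 0 := Complex.ofReal_ne_zero.2 (ne_of_gt ht)
  have hx := div_mem_zeroLocus_of_mem_kerLocus_coneMap hp (hp0 ▸ ht')
  refine ⟨t, ht, fun i => p i.succ / p 0, ?_, ?_⟩
  · obtain ⟨I, rfl⟩ := hreal
    intro G hG
    have h1 : G.map (algebraMap ℝ ℂ) ∈ vanishingIdeal ℂ (zeroLocus ℂ I) := by
      intro y hy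
      rw [aeval_map_algebraMap]
      exact hy G hG
    have h2 := hx _ (hXP h1)
    rwa [aeval_map_algebraMap] at h2
  · have e : (t : ℂ) • (fun i : Fin n => p i.succ / p 0) = fun i => p i.succ := by
      ext i
      simp [hp0, mul_div_cancel₀ _ ht']
    rw [e]
    exact hpU

end PosHyp

end

theorem proposition2p9 (n c : ℕ) (X : Set (Fin n → ℂ))
    (hreal : PosHyp.IsRealVariety X) (hcodim : PosHyp.HasCodim X c) :
    (PosHyp.ProjPositivelyHyperbolic c (PosHyp.projClosure X) ↔
      ∀ L ∈ PosHyp.positiveGrassmannian c (n + 1),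
        PosHyp.HyperbolicWRT (PosHyp.projClosure X) L) ∧
    (PosHyp.PositivelyHyperbolic c X ↔
      ∀ L ∈ PosHyp.positiveGrassmannian c n,
        PosHyp.HyperbolicWRT (PosHyp.projClosure X) (PosHyp.zeroProd L)) := by
  open PosHyp in
  simp only [hyperbolicWRT_iff]
  refine ⟨⟨fun h L hL v hv hvX hvL => ?_, fun h L hL v hv hvL => ?_⟩,
    fun h L hL v hv hvX hvL => ?_, fun h L hL x hx hxL => ?_⟩
  · by_contra h0
    exact h L hL v (Or.inr ⟨hv, hvX⟩) ⟨hvL, h0⟩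
  · rcases hv with rfl | ⟨hv0, hvX⟩
    · exact hvL.2 (by ext i; simp [imVec])
    · exact hvL.2 (h L hL v hv0 hvX hvL.1)
  · obtain ⟨him0, himL⟩ := hvL
    replace him0 : (v 0).im = 0 := him0
    replace himL : imVec (fun i : Fin n => v i.succ) ∈ L := himL
    suffices hs : imVec (fun i : Fin n => v i.succ) = 0 by
      ext i
      refine Fin.cases him0 (fun j => congrFun hs j) i
    by_contra hne
    by_cases hv0 : v 0 = 0
    -- At infinity: the nearby `t • x` may have its imaginary part in a different `L'`, which is
    -- harmless since `h` covers every member of the Grassmannian.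
    · have hcont : Continuous fun z : Fin n → ℂ => imVec z :=
        continuous_pi fun i => Complex.continuous_im.comp (continuous_apply i)
      obtain ⟨t, ht, x, hx, hne', L', hL', hmem⟩ := exists_pos_smul_mem_of_mem_projClosure hreal hv
        hvX hv0 (hcont.continuousAt (eventually_mem_positiveGrassmannian hL himL hne))
      have e : imVec ((t : ℂ) • x) = t • imVec x := by ext i; simp [imVec]
      simp only [e] at hne' hmem
      exact h L' hL' x hx ⟨(L'.smul_mem_iff ht.ne').1 hmem, fun h0 => hne' (by
        rw [Set.mem_singleton_iff.1 h0, smul_zero])⟩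
    -- Here `v 0` is a nonzero real, so dehomogenizing only rescales the imaginary part within `L`.
    · have hr : v 0 = ((v 0).re : ℂ) := Complex.ext rfl (by simpa using him0)
      have hre : (v 0).re ≠ 0 := fun h0 => hv0 (by rw [hr, h0, Complex.ofReal_zero])
      have e : imVec (fun i : Fin n => v i.succ / v 0) =
          ((v 0).re)⁻¹ • imVec (fun i : Fin n => v i.succ) := by
        ext i
        simp only [imVec, Pi.smul_apply, smul_eq_mul]
        rw [hr, Complex.div_ofReal_im, Complex.ofReal_re, div_eq_inv_mul]
      refine h L hL _ (mem_of_mem_projClosure hreal hv hvX hv0) ⟨?_, ?_⟩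
      · rw [e]
        exact L.smul_mem _ himL
      · rw [e]
        exact smul_ne_zero (inv_ne_zero hre) hne
  · have h1 := h L hL (Fin.cons 1 x) (fun h => one_ne_zero (congrFun h 0))
      (subset_projClosure X ⟨x, hx, rfl⟩) ⟨by simp [imVec], hxL.1⟩
    exact hxL.2 (by ext i; exact congrFun h1 i.succ)
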